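/- **Theorem.** Let $D$ be a directed graph without self-loops on the nodes $1,\dots,L$. For a node $i$ let $N_i^+$ be the set of its out-neighbours and $d_i^+=|N_i^+|$. Let $\mathcal C$ be the set of measured nodes, and let $C$ be a $p\times L$ selection matrix of $\mathcal C$: each row of $C$ has one entry $1$ and all others $0$, and $\mathcal C$ is the set of nodes selected by the rows. For sets of nodes $\mathcal A,\mathcal B$ let $b_{\mathcal A\to\mathcal B}$ be the maximum number of mutually vertex-disjoint directed paths of $D$ starting in $\mathcal A$ and ending in $\mathcal B$; a path visits no node twice, and a single node counts as a path. A matrix $G(z)$ of real rational functions is *consistent with $D$* if $G_{ij}\neq 0$ only when there is an edge $(j,i)$ from $j$ to $i$. A *rational parametrization consistent with $D$* is given by integers $p_{ij},n_{ij}\ge 0$ for every edge $(j,i)$, and by $$G_{ij}(P,z)=\kappa_{ij}\,z^{-p_{ij}}\,\frac{z^{n_{ij}}+\beta_{ij}^{(n_{ij}-1)}z^{n_{ij}-1}+\dots+\beta_{ij}^{(0)}}{z^{n_{ij}}+\alpha_{ij}^{(n_{ij}-1)}z^{n_{ij}-1}+\dots+\alpha_{ij}^{(0)}}$$ for every edge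 $(j,i)$, with $G_{ij}(P,z)=0$ otherwise. Here $P\in\mathbb R^N$ collects all the real parameters $\kappa_{ij},\alpha_{ij}^{(m)},\beta_{ij}^{(m)}$. Let $\mathcal N$ be a class of admissible networks consistent with $D$. All edges (transfer functions) are *generically identifiable from $C$ within $\mathcal N$* if, for every rational parametrization consistent with $D$, for all $P$ outside a set of Lebesgue measure zero in $\mathbb R^N$: if $G(P,\cdot)\in\mathcal N$, then for every $\tilde G\in\mathcal N$ $$C(I-G(P,z))^{-1}=C(I-\tilde G(z))^{-1}\ \Longrightarrow\ G_{ji}(P,z)=\tilde G_{ji}(z)\ \text{ for every edge }(i,j).$$ The following are equivalent. 1. All edges are generically identifiable from $C$ within the class of all matrices $G$ of real rational functions that are consistent with $D$ and for which $I-G$ is invertible. 2. All edges are generically identifiable from $C$ within the class of all well-posed networks, i.e. matrices $G$ of proper real rational functions consistent with $D$ for which $(I-G)^{-1}$ exists and is proper and stable (all poles in the open unit disc). 3. $b_{N_i^+\to\mathcal C}=d_i^+$ for every node $i$. 4. For every node $i$ there are mutually vertex-disjoint directed paths, one from each out-neighbour of $i$, ending in $\mathcal C$. -/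

import Mathlib

namespace DynNet

/-! ### Directed graphs: out-neighbours and vertex-disjoint paths -/

/-- The set `N_i^+` of out-neighbours of node `i`. -/
def outNeighbors {V : Type*} (D : Digraph V) (i : V) : Set V := {j | D.Adj i j}

/-- The number `d_i^+` of outgoing edges of node `i`. -/
noncomputable def outDegree {V : Type*} (D : Digraph V) (i : V) : ℕ := (outNeighbors D i).ncard

/-- A directed path of `D` starting in `A` and ending in `B`: a nonempty list of pairwise distinct
nodes in which consecutive nodes are joined by edges. A path may consist of a single node. -/
structure DiPath {V : Type*} (D : Digraph V) (A B : Set V) where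
  verts : List V
  ne_nil : verts ≠ []
  nodup : verts.Nodup
  chain : verts.IsChain D.Adj
  head_mem : verts.head ne_nil ∈ A
  last_mem : verts.getLast ne_nil ∈ B

/-- `D` contains `k` mutually vertex-disjoint paths starting in `A` and ending in `B`. -/
def HasDisjointPaths {V : Type*} (D : Digraph V) (A B : Set V) (k : ℕ) : Prop :=
  ∃ π : Fin k → DiPath D A B, Pairwise fun r s => (π r).verts.Disjoint (π s).verts

/-- The number `b_{A → B}`: the maximum number of mutually vertex-disjoint paths starting in `A`
and ending in `B`. -/
noncomputable def maxDisjointPaths {V : Type*} (D : Digraph V) (A B : Set V) : ℕ :=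
  sSup {k | HasDisjointPaths D A B k}

/-- On a finite node set the supremum in `maxDisjointPaths` is a maximum. -/
theorem isGreatest_maxDisjointPaths {V : Type*} [Finite V] (D : Digraph V) (A B : Set V) :
    IsGreatest {k | HasDisjointPaths D A B k} (maxDisjointPaths D A B) := by
  have hne : {k | HasDisjointPaths D A B k}.Nonempty :=
    ⟨0, fun r => r.elim0, fun r => r.elim0⟩
  have hbdd : BddAbove {k | HasDisjointPaths D A B k} := by
    refine ⟨Nat.card V, ?_⟩
    rintro k ⟨π, hπ⟩
    have hinj : Function.Injective fun r : Fin k => (π r).verts.head (π r).ne_nil := by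
      intro r s hrs
      by_contra hne
      have hr := List.head_mem (π r).ne_nil
      have hs := List.head_mem (π s).ne_nil
      have hrs' : (π r).verts.head (π r).ne_nil = (π s).verts.head (π s).ne_nil := hrs
      rw [← hrs'] at hs
      exact hπ hne hr hs
    simpa using Nat.card_le_card_of_injective _ hinj
  exact ⟨Nat.sSup_mem hne hbdd, fun k hk => le_csSup hbdd hk⟩

/-! ### Transfer functions and network matrices

A transfer function is a rational function in `z` with real coefficients. -/

/-- A rational function is proper: the numerator's degree does not exceed the denominator's. -/
def IsProperTF (f : RatFunc ℝ) : Prop := f.num.natDegree ≤ f.denom.natDegree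

/-- Discrete-time stability: all poles lie in the open unit disc. -/
def IsStableTF (f : RatFunc ℝ) : Prop := ∀ z : ℂ, Polynomial.aeval z f.denom = 0 → ‖z‖ < 1

/-- `G` is consistent with the graph: `G i j` may be nonzero only if there is an edge `(j, i)`,
that is, an edge from `j` to `i`. -/
def IsConsistent {L : ℕ} (D : Digraph (Fin L)) (G : Matrix (Fin L) (Fin L) (RatFunc ℝ)) : Prop :=
  ∀ i j, G i j ≠ 0 → D.Adj j i

/-- All matrices of rational functions consistent with the graph for which `(I - G)⁻¹` exists. -/
def rationalNetworks {L : ℕ} (D : Digraph (Fin L)) : Set (Matrix (Fin L) (Fin L) (RatFunc ℝ)) :=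
  {G | IsConsistent D G ∧ IsUnit (1 - G)}

/-- The well-posed networks consistent with the graph: the entries of `G` are proper, and
`(I - G)⁻¹` exists and is proper and stable. -/
def wellPosedNetworks {L : ℕ} (D : Digraph (Fin L)) : Set (Matrix (Fin L) (Fin L) (RatFunc ℝ)) :=
  {G | IsConsistent D G ∧ IsUnit (1 - G) ∧ (∀ i j, IsProperTF (G i j)) ∧
    ∀ i j, IsProperTF ((1 - G)⁻¹ i j) ∧ IsStableTF ((1 - G)⁻¹ i j)}

/-- The `p × L` selection matrix `C` of the measured nodes `c 0, …, c (p - 1)`: row `k` has the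
entry `1` in column `c k`, and `0` elsewhere. The set of measured nodes is `Set.range c`. -/
noncomputable def selectionMatrix {L p : ℕ} (c : Fin p → Fin L) :
    Matrix (Fin p) (Fin L) (RatFunc ℝ) :=
  Matrix.of fun k j => if j = c k then 1 else 0

/-! ### Rational parametrizations and generic identifiability

A parametrization is fixed by the constants `d i j` (delay) and `n i j` (order), one pair for each
edge `(j, i)`. -/

/-- The real parameters of a parametrization of orders `n`: for each edge `e = (j, i)` one gain
`κ`, the `n i j` numerator coefficients `β` and the `n i j` denominator coefficients `α`. -/
abbrev ParamIndex {L : ℕ} (D : Digraph (Fin L)) (n : Fin L → Fin L → ℕ) : Type :=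
  (e : {e : Fin L × Fin L // D.Adj e.1 e.2}) ×
    (Unit ⊕ (Fin (n e.1.2 e.1.1) ⊕ Fin (n e.1.2 e.1.1)))

noncomputable instance paramIndexFintype {L : ℕ} (D : Digraph (Fin L)) (n : Fin L → Fin L → ℕ) :
    Fintype (ParamIndex D n) :=
  Fintype.ofFinite _

/-- The monic polynomial `z ^ m + a (m - 1) z ^ (m - 1) + ⋯ + a 1 z + a 0`, as a rational
function. -/
noncomputable def monicTF {m : ℕ} (a : Fin m → ℝ) : RatFunc ℝ :=
  RatFunc.X ^ m + ∑ t : Fin m, RatFunc.C (a t) * RatFunc.X ^ (t : ℕ)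

open Classical in
/-- The network matrix `G(P, z)` of the parametrization with delays `d` and orders `n`: for an edge
`(j, i)`, `G i j = κ z ^ (-d i j) * (z ^ n + β_{n-1} z ^ (n-1) + ⋯ + β_0) /
(z ^ n + α_{n-1} z ^ (n-1) + ⋯ + α_0)` with `n = n i j`; all other entries vanish. -/
noncomputable def paramNetwork {L : ℕ} (D : Digraph (Fin L)) (d n : Fin L → Fin L → ℕ)
    (P : ParamIndex D n → ℝ) : Matrix (Fin L) (Fin L) (RatFunc ℝ) :=
  Matrix.of fun i j =>
    if h : D.Adj j i then
      RatFunc.C (P ⟨⟨(j, i), h⟩, Sum.inl ()⟩) * (RatFunc.X ^ d i j)⁻¹ *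
        (monicTF (fun t : Fin (n i j) => P ⟨⟨(j, i), h⟩, Sum.inr (Sum.inl t)⟩) /
          monicTF (fun t : Fin (n i j) => P ⟨⟨(j, i), h⟩, Sum.inr (Sum.inr t)⟩))
    else 0

/-- The transfer functions of all edges in `S` are generically identifiable from the nodes measured
by `c`, where `𝒩` is the class of admissible networks consistent with the graph: for every rational
parametrization and Lebesgue-almost every parameter vector `P`, if `G(P)` is admissible, then every
admissible network `G'` with `C (I - G(P))⁻¹ = C (I - G')⁻¹` agrees with `G(P)` on `S`. -/
def GenericallyIdentifiable {L p : ℕ} (D : Digraph (Fin L)) (c : Fin p → Fin L)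
    (𝒩 : Set (Matrix (Fin L) (Fin L) (RatFunc ℝ))) (S : Set (Fin L × Fin L)) : Prop :=
  ∀ d n : Fin L → Fin L → ℕ, ∀ᵐ P : ParamIndex D n → ℝ ∂MeasureTheory.volume,
    paramNetwork D d n P ∈ 𝒩 → ∀ G' ∈ 𝒩,
      selectionMatrix c * (1 - paramNetwork D d n P)⁻¹ = selectionMatrix c * (1 - G')⁻¹ →
        ∀ e ∈ S, paramNetwork D d n P e.2 e.1 = G' e.2 e.1

/-- The set of all edges `(i, j)` of the graph. -/
def edges {L : ℕ} (D : Digraph (Fin L)) : Set (Fin L × Fin L) := {e | D.Adj e.1 e.2}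

end DynNet

/-!
Fix a node `i`, let `A` be its set of out-neighbours and `B` the set of measured nodes.

Combinatorics. Disjoint paths to `B`, one from each node of `A`, amount to a *linking map*: an
injective map `φ : Bᶜ → Aᶜ` with `φ v = v` or an edge `(v, φ v)` for every `v`. The successor map of
the paths is one (`HasLinkage.exists_isLinking`), and the orbits of a linking map starting in `A`
are disjoint paths (`IsLinking.hasLinkage`). So a linkage is a matching in a bipartite graph, which
is the graph of the possibly nonzero entries of the block of `I - G` with rows `Aᶜ` and columns
`Bᶜ`, and Hall's theorem takes the place of Menger's.

Sufficiency. Suppose `G` and `G'` give the same measured transfer functions, let `x` be column `i`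
of `G' - G` and `y = (I - G)⁻¹ x`. Then `y` vanishes on `B` and `(I - G) y = x` vanishes off `A`, so
`y = 0` as soon as the minor of `I - G` with rows `φ(Bᶜ)` and columns `Bᶜ` is nonzero
(`IsLinking.column_eq`). With the denominators cleared this minor is a polynomial in `z` and the
parameters. It is not the zero polynomial: with gain `2` on the edges `(v, φ v)` and all other
parameters zero, the block, with rows matched to columns by `φ`, is diagonally dominant at `z = 1`. Hence it is nonzero for almost all
parameters, because the zero set of a nonzero real polynomial is a null set (`ae_eval_ne_zero`).

Necessity. Without a linkage, Hall's theorem gives for every consistent `G` a vector `y ≠ 0` that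
vanishes on `B` while `(I - G) y` vanishes off `A` (`exists_ne_zero_of_not_hasLinkage`). A multiple
`w` of `y` is strictly proper with all poles at the origin, and then `(I + w eᵢᵀ) (I - G)⁻¹` is the
transfer matrix of another well-posed network with the same measured rows and a different column
`i` (`exists_indistinguishable`). This contradicts identifiability at any well-posed `G(P)`. Static
networks, with real constants on the edges, are well posed for a nonempty open set of parameters,
so they include one at which identifiability holds.
-/

namespace DynNet

open MeasureTheory Polynomial
open scoped Matrix

/-! ### Linking maps -/

/-- A map that leaves every node of `Bᶜ` fixed or moves it along an edge, injectively and without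
hitting `A`. Such a map encodes vertex-disjoint paths from all of `A` to `B`: it sends each node of
such a path to the next one, and fixes the nodes off the paths. Values on `B` are irrelevant. -/
def IsLinking {V : Type*} (D : Digraph V) (A B : Set V) (φ : V → V) : Prop :=
  Set.InjOn φ Bᶜ ∧ ∀ v ∉ B, φ v ∉ A ∧ (φ v = v ∨ D.Adj v (φ v))

/-- There are mutually vertex-disjoint paths to `B`, one from each node of `A`. -/
def HasLinkage {V : Type*} (D : Digraph V) (A B : Set V) : Prop :=
  ∃ π : ∀ j : A, DiPath D {(j : V)} B, Pairwise fun j k => (π j).verts.Disjoint (π k).verts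

section Linking

variable {V : Type*} {D : Digraph V} {A B : Set V}

/-- Orbits of a linking map that start in `A` and have not yet reached `B` never meet, neither
themselves nor each other: the map is injective there, and cannot return to `A`. -/
theorem IsLinking.iterate_inj {φ : V → V} (hφ : IsLinking D A B φ) {j k : V} (hj : j ∈ A)
    (hk : k ∈ A) : ∀ {a b : ℕ}, (∀ m < a, φ^[m] j ∉ B) → (∀ m < b, φ^[m] k ∉ B) →
      φ^[a] j = φ^[b] k → a = b ∧ j = k
  | 0, 0, _, _, h => ⟨rfl, h⟩
  | 0, b + 1, _, hb, h => by
    rw [Function.iterate_succ_apply'] at h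
    exact absurd (h ▸ hj) (hφ.2 _ (hb b b.lt_succ_self)).1
  | a + 1, 0, ha, _, h => by
    rw [Function.iterate_succ_apply'] at h
    exact absurd (h.symm ▸ hk) (hφ.2 _ (ha a a.lt_succ_self)).1
  | a + 1, b + 1, ha, hb, h => by
    rw [Function.iterate_succ_apply', Function.iterate_succ_apply'] at h
    have h' := hφ.1 (ha a a.lt_succ_self) (hb b b.lt_succ_self) h
    obtain ⟨h1, h2⟩ := hφ.iterate_inj hj hk (fun m hm => ha m (by omega))
      (fun m hm => hb m (by omega)) h'
    exact ⟨by omega, h2⟩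

theorem IsLinking.exists_iterate_mem [Finite V] {φ : V → V} (hφ : IsLinking D A B φ) {j : V}
    (hj : j ∈ A) : ∃ m, φ^[m] j ∈ B := by
  by_contra! h
  exact not_injective_infinite_finite (fun m : ℕ => φ^[m] j) fun a b hab =>
    (hφ.iterate_inj hj hj (fun m _ => h m) (fun m _ => h m) hab).1

/-- Following a linking map from each node of `A` until `B` is reached gives disjoint paths. -/
theorem IsLinking.hasLinkage [Finite V] {φ : V → V} (hφ : IsLinking D A B φ) :
    HasLinkage D A B := by
  classical
  have hex : ∀ j : A, ∃ m, φ^[m] (j : V) ∈ B ∧ ∀ l < m, φ^[l] (j : V) ∉ B := fun j =>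
    ⟨Nat.find (hφ.exists_iterate_mem j.2), Nat.find_spec (hφ.exists_iterate_mem j.2),
      fun l hl => Nat.find_min (hφ.exists_iterate_mem j.2) hl⟩
  choose N hN hlt using hex
  refine ⟨fun j =>
    { verts := List.iterate φ j (N j + 1)
      ne_nil := List.ne_nil_of_length_pos (by simp)
      nodup := ?_
      chain := ?_
      head_mem := by simp [List.iterate]
      last_mem := ?_ }, ?_⟩
  · rw [List.nodup_iff_injective_getElem]
    rintro ⟨a, ha⟩ ⟨b, hb⟩ hab
    simp only [List.length_iterate] at ha hb
    simp only [List.getElem_iterate] at hab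
    exact Fin.ext (hφ.iterate_inj j.2 j.2 (fun m hm => hlt j m (by omega))
      (fun m hm => hlt j m (by omega)) hab).1
  · rw [List.isChain_iff_getElem]
    intro a ha
    simp only [List.length_iterate] at ha
    simp only [List.getElem_iterate]
    rcases (hφ.2 _ (hlt j a (by omega))).2 with h | h
    · rw [← Function.iterate_succ_apply' φ] at h
      have := (hφ.iterate_inj j.2 j.2 (a := a + 1) (b := a) (fun m hm => hlt j m (by omega))
        (fun m hm => hlt j m (by omega)) h).1
      omega
    · rwa [← Function.iterate_succ_apply' φ] at h
  · rw [List.getLast_eq_getElem]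
    simp only [List.getElem_iterate, List.length_iterate, Nat.add_sub_cancel]
    exact hN j
  · intro j k hjk v hv hw
    obtain ⟨a, ha, rfl⟩ := List.mem_iterate.1 hv
    obtain ⟨b, hb, hab⟩ := List.mem_iterate.1 hw
    exact hjk (Subtype.ext (hφ.iterate_inj j.2 k.2 (fun m hm => hlt j m (by omega))
      (fun m hm => hlt k m (by omega)) hab).2)

/-- The successor map of a system of disjoint paths is a linking map. Closing each path up to a
cycle (`List.formPerm`) makes it injective; the closing arrows start in `B`, where the values of a
linking map do not matter. -/
theorem HasLinkage.exists_isLinking (h : HasLinkage D A B) : ∃ φ : V → V, IsLinking D A B φ := by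
  classical
  obtain ⟨π, hπ⟩ := h
  have huniq : ∀ {j k : A} {v : V}, v ∈ (π j).verts → v ∈ (π k).verts → j = k := by
    intro j k v hj hk
    by_contra hne
    exact hπ hne hj hk
  have hhead : ∀ j : A, (π j).verts.head (π j).ne_nil = j := fun j => (π j).head_mem
  let φ : V → V := fun v =>
    if h : ∃ j, v ∈ (π j).verts then (π h.choose).verts.formPerm v else v
  have hon : ∀ {j : A} {v : V}, v ∈ (π j).verts → φ v = (π j).verts.formPerm v := by
    intro j v hv
    have hex : ∃ j, v ∈ (π j).verts := ⟨j, hv⟩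
    simp only [φ, dif_pos hex]
    rw [huniq hex.choose_spec hv]
  have hoff : ∀ {v : V}, (¬ ∃ j, v ∈ (π j).verts) → φ v = v := fun h => dif_neg h
  have hmem : ∀ {j : A} {v : V}, φ v ∈ (π j).verts ↔ v ∈ (π j).verts := by
    intro j v
    by_cases hv : ∃ k, v ∈ (π k).verts
    · obtain ⟨k, hk⟩ := hv
      rw [hon hk]
      constructor
      · intro h
        obtain rfl := huniq h (List.formPerm_apply_mem_of_mem hk)
        exact hk
      · intro h
        obtain rfl := huniq h hk
        exact List.formPerm_apply_mem_of_mem hk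
    · rw [hoff hv]
  refine ⟨φ, fun v _ w _ hvw => ?_, fun v hvB => ?_⟩
  · by_cases hv : ∃ k, v ∈ (π k).verts
    · obtain ⟨k, hk⟩ := hv
      have hw : w ∈ (π k).verts := hmem.1 (hvw ▸ hmem.2 hk)
      rw [hon hk, hon hw] at hvw
      exact (List.formPerm _).injective hvw
    · have hw : ¬ ∃ k, w ∈ (π k).verts := fun ⟨k, hk⟩ => hv ⟨k, hmem.1 (hvw.symm ▸ hmem.2 hk)⟩
      rwa [hoff hv, hoff hw] at hvw
  · by_cases hv : ∃ k, v ∈ (π k).verts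
    · obtain ⟨k, hk⟩ := hv
      obtain ⟨n, hn, rfl⟩ := List.getElem_of_mem hk
      have hn1 : n + 1 < (π k).verts.length := by
        by_contra hlast
        apply hvB
        have := (π k).last_mem
        rw [List.getLast_eq_getElem] at this
        convert this using 2
        omega
      rw [hon hk, List.formPerm_apply_lt_getElem _ (π k).nodup n hn1]
      refine ⟨fun hA => ?_, Or.inr (List.isChain_iff_getElem.1 (π k).chain n hn1)⟩
      -- A node of `A` is the head of its own path, so it does not follow another node.
      have h0 := hhead ⟨_, hA⟩
      have hk' : (⟨_, hA⟩ : A) = k :=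
        huniq (List.head_mem (π ⟨_, hA⟩).ne_nil) (by rw [h0]; exact List.getElem_mem hn1)
      have h1 := congrArg Subtype.val hk'
      have h2 := h1.trans (hhead k).symm
      rw [List.head_eq_getElem] at h2
      have := (List.Nodup.getElem_inj_iff (π k).nodup).1 h2
      omega
    · rw [hoff hv]
      refine ⟨fun hA => hv ⟨⟨v, hA⟩, ?_⟩, Or.inl rfl⟩
      have := List.head_mem (π ⟨v, hA⟩).ne_nil
      rwa [hhead] at this

/-- The heads of disjoint paths starting in `A` are distinct. -/
theorem injective_head_of_disjoint {k : ℕ} {π : Fin k → DiPath D A B}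
    (hπ : Pairwise fun r s => (π r).verts.Disjoint (π s).verts) :
    Function.Injective fun r => (⟨(π r).verts.head (π r).ne_nil, (π r).head_mem⟩ : A) := by
  intro r s hrs
  by_contra hne
  have hrs' := congrArg Subtype.val hrs
  have hs := List.head_mem (π s).ne_nil
  simp only at hrs'
  rw [← hrs'] at hs
  exact hπ hne (List.head_mem _) hs

/-- The maximum number of disjoint paths from `A` to `B` equals `|A|` exactly when all nodes of `A`
are linked to `B` simultaneously. -/
theorem maxDisjointPaths_eq_ncard_iff [Finite V] :
    maxDisjointPaths D A B = A.ncard ↔ HasLinkage D A B := by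
  constructor
  · intro h
    obtain ⟨π, hπ⟩ := (isGreatest_maxDisjointPaths D A B).1
    have hbij := (Nat.bijective_iff_injective_and_card _).2
      ⟨injective_head_of_disjoint hπ, by rw [Nat.card_fin, h]; rfl⟩
    let e := Equiv.ofBijective _ hbij
    refine ⟨fun j =>
      { verts := (π (e.symm j)).verts
        ne_nil := (π (e.symm j)).ne_nil
        nodup := (π (e.symm j)).nodup
        chain := (π (e.symm j)).chain
        head_mem := congrArg Subtype.val (e.apply_symm_apply j)
        last_mem := (π (e.symm j)).last_mem }, fun j k hjk => hπ (e.symm.injective.ne hjk)⟩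
  · rintro ⟨π, hπ⟩
    apply le_antisymm
    · obtain ⟨π, hπ⟩ := (isGreatest_maxDisjointPaths D A B).1
      have := Nat.card_le_card_of_injective _ (injective_head_of_disjoint hπ)
      rwa [Nat.card_fin] at this
    · let e : Fin A.ncard ≃ A := (Finite.equivFin A).symm
      refine (isGreatest_maxDisjointPaths D A B).2 ⟨fun r =>
        { verts := (π (e r)).verts
          ne_nil := (π (e r)).ne_nil
          nodup := (π (e r)).nodup
          chain := (π (e r)).chain
          head_mem := ?_
          last_mem := (π (e r)).last_mem }, fun r s hrs => hπ (e.injective.ne hrs)⟩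
      have : (π (e r)).verts.head (π (e r)).ne_nil = e r := (π (e r)).head_mem
      rw [this]
      exact (e r).2

end Linking

/-! ### Zero sets of real polynomials -/

theorem ae_eval_ne_zero_fin : ∀ {n : ℕ} {p : MvPolynomial (Fin n) ℝ}, p ≠ 0 →
    ∀ᵐ x : Fin n → ℝ, MvPolynomial.eval x p ≠ 0
  | 0, p, hp => by
    refine Filter.Eventually.of_forall fun x hx => hp ?_
    exact MvPolynomial.funext fun y => by rw [Subsingleton.elim y x, hx, map_zero]
  | n + 1, p, hp => by
    have hmeas : MeasurableSet {x : Fin (n + 1) → ℝ | MvPolynomial.eval x p ≠ 0} :=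
      (isOpen_ne_fun (MvPolynomial.continuous_eval p) continuous_const).measurableSet
    have hmp := volume_preserving_piFinSuccAbove (fun _ : Fin (n + 1) => ℝ) 0
    rw [← hmp.symm.map_eq, ae_map_iff hmp.symm.measurable.aemeasurable hmeas,
      Measure.volume_eq_prod]
    have hmeas' : MeasurableSet {y : ℝ × (Fin n → ℝ) | MvPolynomial.eval
        ((MeasurableEquiv.piFinSuccAbove (fun _ : Fin (n + 1) => ℝ) 0).symm y) p ≠ 0} :=
      hmp.symm.measurable hmeas
    rw [← Measure.prod_swap, ae_map_iff measurable_swap.aemeasurable hmeas']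
    refine (Measure.ae_prod_iff_ae_ae (measurable_swap hmeas')).2 ?_
    -- For almost every choice of the last `n` variables some coefficient in the first variable
    -- survives, and then only finitely many values of the first variable are roots.
    have hq : MvPolynomial.finSuccEquiv ℝ n p ≠ 0 :=
      (map_ne_zero_iff _ (MvPolynomial.finSuccEquiv ℝ n).injective).2 hp
    obtain ⟨k, hk⟩ : ∃ k, (MvPolynomial.finSuccEquiv ℝ n p).coeff k ≠ 0 := by
      by_contra! h
      exact hq (Polynomial.ext (by simpa using h))
    filter_upwards [ae_eval_ne_zero_fin hk] with s hs
    have hs' : (MvPolynomial.finSuccEquiv ℝ n p).map (MvPolynomial.eval s) ≠ 0 := by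
      intro h0
      apply hs
      rw [← Polynomial.coeff_map, h0, Polynomial.coeff_zero]
    have hfin := Polynomial.finite_setOfPred_isRoot hs'
    filter_upwards [hfin.countable.ae_notMem volume] with y hy hz
    apply hy
    have : (MeasurableEquiv.piFinSuccAbove (fun _ : Fin (n + 1) => ℝ) 0).symm (y, s) =
        (Fin.cons y s : Fin (n + 1) → ℝ) := by
      simp [MeasurableEquiv.piFinSuccAbove]
      rfl
    simp only [Prod.swap_prod_mk] at hz
    rw [this, MvPolynomial.eval_eq_eval_mv_eval'] at hz
    exact hz

/-- The zero set of a nonzero real polynomial is a Lebesgue null set. -/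
theorem ae_eval_ne_zero {σ : Type*} [Fintype σ] {p : MvPolynomial σ ℝ} (hp : p ≠ 0) :
    ∀ᵐ x : σ → ℝ, MvPolynomial.eval x p ≠ 0 := by
  let e := Fintype.equivFin σ
  have hmp := volume_measurePreserving_piCongrLeft (fun _ : σ => ℝ) e.symm
  have hmeas : MeasurableSet {x : σ → ℝ | MvPolynomial.eval x p ≠ 0} :=
    (isOpen_ne_fun (MvPolynomial.continuous_eval p) continuous_const).measurableSet
  rw [← hmp.map_eq, ae_map_iff hmp.measurable.aemeasurable hmeas]
  have hq : MvPolynomial.rename e p ≠ 0 :=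
    (map_ne_zero_iff _ (MvPolynomial.rename_injective _ e.injective)).2 hp
  filter_upwards [ae_eval_ne_zero_fin hq] with x hx
  rw [MvPolynomial.eval_rename] at hx
  convert hx using 2
  congr 1
  ext s
  have := MeasurableEquiv.piCongrLeft_apply_apply e.symm (β := fun _ => ℝ) x (e s)
  simpa using this

/-- A polynomial whose coefficients are polynomials in real parameters, and which is nonzero for
some values of the parameters, is nonzero for almost all values. -/
theorem ae_map_eval_ne_zero {σ : Type*} [Fintype σ] {F : (MvPolynomial σ ℝ)[X]} {x₀ : σ → ℝ}
    (h : F.map (MvPolynomial.eval x₀) ≠ 0) :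
    ∀ᵐ x : σ → ℝ, F.map (MvPolynomial.eval x) ≠ 0 := by
  have hF : F ≠ 0 := by
    rintro rfl
    simp at h
  obtain ⟨k, hk⟩ : ∃ k, F.coeff k ≠ 0 := by
    by_contra! h
    exact hF (Polynomial.ext (by simpa using h))
  filter_upwards [ae_eval_ne_zero hk] with x hx h0
  apply hx
  rw [← Polynomial.coeff_map, h0, Polynomial.coeff_zero]

/-! ### Clearing the denominators of a parametrization -/

section Cleared

variable {R S : Type*} [CommRing R] [CommRing S] {L : ℕ} {D : Digraph (Fin L)}
  {n : Fin L → Fin L → ℕ}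

/-- The monic polynomial `z ^ m + a (m - 1) z ^ (m - 1) + ⋯ + a 0`. -/
noncomputable def monicPoly {m : ℕ} (a : Fin m → R) : R[X] :=
  X ^ m + ∑ t : Fin m, C (a t) * X ^ (t : ℕ)

theorem monicPoly_map {m : ℕ} (f : R →+* S) (a : Fin m → R) :
    (monicPoly a).map f = monicPoly (f ∘ a) := by
  simp [monicPoly, Polynomial.map_sum]

theorem monicPoly_monic [Nontrivial R] {m : ℕ} (a : Fin m → R) : (monicPoly a).Monic := by
  refine Polynomial.monic_X_pow_add ((Polynomial.degree_sum_le _ _).trans_lt ?_)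
  refine (Finset.sup_lt_iff (WithBot.bot_lt_coe m)).2 fun t _ => ?_
  exact (Polynomial.degree_C_mul_X_pow_le _ _).trans_lt (Nat.cast_lt.2 t.2)

theorem algebraMap_monicPoly {m : ℕ} (a : Fin m → ℝ) :
    algebraMap ℝ[X] (RatFunc ℝ) (monicPoly a) = monicTF a := by
  simp [monicPoly, monicTF]

open Classical in
/-- The numerator of the entry `e = (i, j)` of the network matrix, for parameters in any ring. -/
noncomputable def entryNum (D : Digraph (Fin L)) (n : Fin L → Fin L → ℕ)
    (P : ParamIndex D n → R) (e : Fin L × Fin L) : R[X] :=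
  if h : D.Adj e.2 e.1 then
    C (P ⟨⟨(e.2, e.1), h⟩, Sum.inl ()⟩) *
      monicPoly (fun t : Fin (n e.1 e.2) => P ⟨⟨(e.2, e.1), h⟩, Sum.inr (Sum.inl t)⟩)
  else 0

open Classical in
/-- The denominator of the entry `e = (i, j)` of the network matrix; it is `1` off the edges. -/
noncomputable def entryDen (D : Digraph (Fin L)) (d n : Fin L → Fin L → ℕ)
    (P : ParamIndex D n → R) (e : Fin L × Fin L) : R[X] :=
  if h : D.Adj e.2 e.1 then
    X ^ d e.1 e.2 *
      monicPoly (fun t : Fin (n e.1 e.2) => P ⟨⟨(e.2, e.1), h⟩, Sum.inr (Sum.inr t)⟩)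
  else 1

/-- The polynomial matrix obtained from `I - G` by multiplication with the product of all
denominators, for parameters in any ring. -/
noncomputable def clearedMatrix (D : Digraph (Fin L)) (d n : Fin L → Fin L → ℕ)
    (P : ParamIndex D n → R) : Matrix (Fin L) (Fin L) R[X] :=
  Matrix.of fun i j => (if i = j then ∏ e, entryDen D d n P e else 0) -
    entryNum D n P (i, j) * ∏ e ∈ Finset.univ.erase (i, j), entryDen D d n P e

theorem entryNum_map (f : R →+* S) (P : ParamIndex D n → R) (e : Fin L × Fin L) :
    (entryNum D n P e).map f = entryNum D n (f ∘ P) e := by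
  unfold entryNum
  split_ifs
  · simp [monicPoly_map, Function.comp_def]
  · simp

theorem entryDen_map (d : Fin L → Fin L → ℕ) (f : R →+* S) (P : ParamIndex D n → R)
    (e : Fin L × Fin L) : (entryDen D d n P e).map f = entryDen D d n (f ∘ P) e := by
  unfold entryDen
  split_ifs
  · simp [monicPoly_map, Function.comp_def]
  · simp

theorem clearedMatrix_map (d : Fin L → Fin L → ℕ) (f : R →+* S) (P : ParamIndex D n → R) :
    (clearedMatrix D d n P).map (Polynomial.map f) = clearedMatrix D d n (f ∘ P) := by
  ext1 i j
  simp only [clearedMatrix, Matrix.map_apply, Matrix.of_apply, Polynomial.map_sub,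
    Polynomial.map_mul, Polynomial.map_prod, entryNum_map, entryDen_map]
  split_ifs
  · rw [Polynomial.map_prod]
    simp only [entryDen_map]
  · simp

theorem entryDen_ne_zero (d : Fin L → Fin L → ℕ) (P : ParamIndex D n → ℝ) (e : Fin L × Fin L) :
    entryDen D d n P e ≠ 0 := by
  unfold entryDen
  split_ifs
  · exact mul_ne_zero (pow_ne_zero _ Polynomial.X_ne_zero) (monicPoly_monic _).ne_zero
  · exact one_ne_zero

theorem paramNetwork_apply_eq_div (d : Fin L → Fin L → ℕ) (P : ParamIndex D n → ℝ) (i j : Fin L) :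
    paramNetwork D d n P i j =
      algebraMap ℝ[X] (RatFunc ℝ) (entryNum D n P (i, j)) /
        algebraMap ℝ[X] (RatFunc ℝ) (entryDen D d n P (i, j)) := by
  unfold paramNetwork entryNum entryDen
  simp only [Matrix.of_apply]
  split_ifs
  · simp only [map_mul, map_pow, algebraMap_monicPoly, RatFunc.algebraMap_X, RatFunc.algebraMap_C]
    rw [mul_div_mul_comm, div_eq_mul_inv (RatFunc.C _)]
  · simp

theorem algebraMap_clearedMatrix (d : Fin L → Fin L → ℕ) (P : ParamIndex D n → ℝ) :
    (clearedMatrix D d n P).map (algebraMap ℝ[X] (RatFunc ℝ)) =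
      algebraMap ℝ[X] (RatFunc ℝ) (∏ e, entryDen D d n P e) • (1 - paramNetwork D d n P) := by
  ext1 i j
  have hden : algebraMap ℝ[X] (RatFunc ℝ) (entryDen D d n P (i, j)) ≠ 0 :=
    (map_ne_zero_iff _ (IsFractionRing.injective ℝ[X] (RatFunc ℝ))).2 (entryDen_ne_zero d P _)
  rw [Matrix.map_apply, Matrix.smul_apply, Matrix.sub_apply, clearedMatrix, Matrix.of_apply,
    map_sub, smul_eq_mul, mul_sub, paramNetwork_apply_eq_div]
  congr 1
  · rw [Matrix.one_apply]
    split_ifs <;> simp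
  · rw [← Finset.mul_prod_erase Finset.univ (entryDen D d n P) (Finset.mem_univ (i, j)), map_mul,
      map_mul]
    field_simp

end Cleared

/-! ### Linking maps imply generic identifiability -/

section Sufficiency

variable {L p : ℕ} {D : Digraph (Fin L)} {n : Fin L → Fin L → ℕ} {A B : Set (Fin L)}
  {φ : Fin L → Fin L}

theorem IsLinking.exists_det_clearedMatrix_ne_zero [Fintype ↥Bᶜ] (hφ : IsLinking D A B φ)
    (d : Fin L → Fin L → ℕ) :
    ∃ P : ParamIndex D n → ℝ, ((clearedMatrix D d n P).submatrix (fun v : ↥Bᶜ => φ v)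
      (fun v : ↥Bᶜ => (v : Fin L))).det ≠ 0 := by
  classical
  -- All denominators are powers of `z`, and at `z = 1` the network has gain `2` on the edges
  -- `(v, φ v)` with `φ v ≠ v` and `0` elsewhere. Each row of the submatrix then has the diagonal
  -- entry `1` and zeros, or the diagonal entry `-2` and at most one further entry, equal to `1`.
  let P : ParamIndex D n → ℝ := fun s =>
    Sum.elim (fun _ => if φ s.1.1.1 = s.1.1.2 ∧ φ s.1.1.1 ≠ s.1.1.1 then 2 else 0)
      (fun _ => 0) s.2
  refine ⟨P, fun hdet => ?_⟩
  have hmonic : ∀ m : ℕ, (monicPoly (fun _ : Fin m => (0 : ℝ))).eval 1 = 1 := by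
    intro m
    simp [monicPoly]
  have hden : ∀ e, (entryDen D d n P e).eval 1 = 1 := by
    intro e
    unfold entryDen
    split_ifs
    · simp [P, hmonic]
    · simp
  have hnum : ∀ i j, (entryNum D n P (i, j)).eval 1 =
      if D.Adj j i ∧ φ j = i ∧ φ j ≠ j then 2 else 0 := by
    intro i j
    unfold entryNum
    by_cases h : D.Adj j i
    · simp [h, P, hmonic]
    · simp [h]
  have hentry : ∀ v' v : ↥Bᶜ, ((clearedMatrix D d n P) (φ v') v).eval 1 =
      (if φ v' = v then 1 else 0) - (if v = v' ∧ φ v ≠ v then (2 : ℝ) else 0) := by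
    intro v' v
    rw [clearedMatrix, Matrix.of_apply, eval_sub, eval_mul, eval_prod, hnum]
    simp only [hden, Finset.prod_const_one, mul_one]
    congr 1
    · split_ifs
      · simp [eval_prod, hden]
      · simp
    · refine if_congr ⟨fun ⟨_, h2, h3⟩ => ⟨Subtype.ext (hφ.1 v.2 v'.2 h2), h3⟩, ?_⟩ rfl rfl
      rintro ⟨rfl, h⟩
      exact ⟨(hφ.2 _ v.2).2.resolve_left h, rfl, h⟩
  have hdet1 := congrArg (Polynomial.evalRingHom (1 : ℝ)) hdet
  rw [RingHom.map_det, map_zero] at hdet1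
  revert hdet1
  apply det_ne_zero_of_sum_row_lt_diag
  intro v'
  simp only [RingHom.mapMatrix_apply, Matrix.map_apply, Matrix.submatrix_apply,
    Polynomial.coe_evalRingHom, hentry]
  have hoff : ∀ v ∈ Finset.univ.erase v', ‖(if φ v' = (v : Fin L) then (1 : ℝ) else 0) -
      (if v = v' ∧ φ v ≠ v then (2 : ℝ) else 0)‖ = if φ v' = v then 1 else 0 := by
    intro v hv
    have hne : ¬ (v = v' ∧ φ v ≠ v) := fun h => (Finset.mem_erase.1 hv).1 h.1
    rw [if_neg hne, sub_zero]
    split_ifs <;> simp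
  rw [Finset.sum_congr rfl hoff]
  by_cases h : φ v' = v'
  · have : ∀ v ∈ Finset.univ.erase v', (if φ v' = (v : Fin L) then (1 : ℝ) else 0) = 0 := by
      intro v hv
      exact if_neg fun h' => (Finset.mem_erase.1 hv).1 (Subtype.ext (h'.symm.trans h))
    rw [Finset.sum_congr rfl this]
    simp [h]
  · have : ∑ v ∈ Finset.univ.erase v', (if φ v' = (v : Fin L) then (1 : ℝ) else 0) ≤ 1 := by
      rw [Finset.sum_boole]
      have : (Finset.filter (fun v : ↥Bᶜ => φ v' = (v : Fin L)) (Finset.univ.erase v')).card ≤ 1 :=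
        Finset.card_le_one.2 fun a ha b hb => Subtype.ext
          ((Finset.mem_filter.1 ha).2.symm.trans (Finset.mem_filter.1 hb).2)
      exact_mod_cast this
    refine this.trans_lt ?_
    simp [h]

/-- The minor of `I - G(P)` singled out by a linking map is nonzero for almost every `P`. -/
theorem IsLinking.ae_det_ne_zero [Fintype ↥Bᶜ] (hφ : IsLinking D A B φ)
    (d n : Fin L → Fin L → ℕ) :
    ∀ᵐ P : ParamIndex D n → ℝ, ((1 - paramNetwork D d n P).submatrix (fun v : ↥Bᶜ => φ v)
      (fun v : ↥Bᶜ => (v : Fin L))).det ≠ 0 := by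
  classical
  let F : (MvPolynomial (ParamIndex D n) ℝ)[X] :=
    ((clearedMatrix D d n
      (MvPolynomial.X : ParamIndex D n → MvPolynomial (ParamIndex D n) ℝ)).submatrix
      (fun v : ↥Bᶜ => φ v) (fun v : ↥Bᶜ => (v : Fin L))).det
  have hF : ∀ P : ParamIndex D n → ℝ, F.map (MvPolynomial.eval P) =
      ((clearedMatrix D d n P).submatrix (fun v : ↥Bᶜ => φ v)
        (fun v : ↥Bᶜ => (v : Fin L))).det := by
    intro P
    rw [← Polynomial.coe_mapRingHom, RingHom.map_det, RingHom.mapMatrix_apply,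
      ← Matrix.submatrix_map, Polynomial.coe_mapRingHom, clearedMatrix_map]
    congr 3
    funext s
    simp
  obtain ⟨P₀, hP₀⟩ := hφ.exists_det_clearedMatrix_ne_zero (n := n) d
  rw [← hF] at hP₀
  filter_upwards [ae_map_eval_ne_zero hP₀] with P hP h0
  apply hP
  rw [hF]
  apply IsFractionRing.injective ℝ[X] (RatFunc ℝ)
  rw [RingHom.map_det, RingHom.mapMatrix_apply, ← Matrix.submatrix_map, map_zero,
    algebraMap_clearedMatrix, Matrix.submatrix_smul]
  simp only [Pi.smul_apply]
  rw [Matrix.det_smul, h0, mul_zero]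

theorem selectionMatrix_mulVec (c : Fin p → Fin L) (y : Fin L → RatFunc ℝ) (k : Fin p) :
    (selectionMatrix c *ᵥ y) k = y (c k) := by
  simp [selectionMatrix, Matrix.mulVec, dotProduct]

/-- If two networks agree on the measured nodes, the difference `x` of their `i`-th columns and
`y = (I - G)⁻¹ x` satisfy: `y` vanishes on the measured nodes, and `(I - G) y = x` vanishes off the
out-neighbours of `i`. A nonzero minor of `I - G` with columns the unmeasured nodes and rows off
the out-neighbours of `i` then forces `y = 0`. -/
theorem IsLinking.column_eq {i : Fin L} {c : Fin p → Fin L}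
    [Fintype ↥(Set.range c)ᶜ] (hφ : IsLinking D (outNeighbors D i) (Set.range c) φ)
    {G G' : Matrix (Fin L) (Fin L) (RatFunc ℝ)} (hG : G ∈ rationalNetworks D)
    (hG' : G' ∈ rationalNetworks D)
    (hdet : ((1 - G).submatrix (fun v : ↥(Set.range c)ᶜ => φ v)
      (fun v : ↥(Set.range c)ᶜ => (v : Fin L))).det ≠ 0)
    (hT : selectionMatrix c * (1 - G)⁻¹ = selectionMatrix c * (1 - G')⁻¹) (j : Fin L) :
    G j i = G' j i := by
  classical
  have hu : IsUnit (1 - G).det := (Matrix.isUnit_iff_isUnit_det _).1 hG.2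
  have hu' : IsUnit (1 - G').det := (Matrix.isUnit_iff_isUnit_det _).1 hG'.2
  let x : Fin L → RatFunc ℝ := (G' - G).col i
  let y : Fin L → RatFunc ℝ := (1 - G)⁻¹ *ᵥ x
  have hyx : (1 - G) *ᵥ y = x := by
    simp only [y, Matrix.mulVec_mulVec, Matrix.mul_nonsing_inv _ hu, Matrix.one_mulVec]
  have hC : selectionMatrix c * (1 - G)⁻¹ * (G' - G) = 0 := by
    have h1 : G' - G = (1 - G) - (1 - G') := by abel
    rw [h1, Matrix.mul_sub, Matrix.nonsing_inv_mul_cancel_right _ _ hu, hT,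
      Matrix.nonsing_inv_mul_cancel_right _ _ hu', sub_self]
  have hy : ∀ k, y (c k) = 0 := by
    intro k
    rw [← selectionMatrix_mulVec c y, Matrix.mulVec_mulVec]
    exact congrFun (congrFun hC k) i
  have hx : ∀ w, w ∉ outNeighbors D i → x w = 0 := by
    intro w hw
    have h1 : G w i = 0 := by
      by_contra h
      exact hw (hG.1 _ _ h)
    have h2 : G' w i = 0 := by
      by_contra h
      exact hw (hG'.1 _ _ h)
    simp [x, h1, h2]
  have hsub : (1 - G).submatrix (fun v : ↥(Set.range c)ᶜ => φ v)
      (fun v : ↥(Set.range c)ᶜ => (v : Fin L)) *ᵥ (fun v : ↥(Set.range c)ᶜ => y v) = 0 := by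
    funext v'
    have h := congrFun hyx (φ v')
    rw [hx _ (hφ.2 _ v'.2).1, Matrix.mulVec, dotProduct] at h
    rw [Pi.zero_apply, ← h, Matrix.mulVec, dotProduct]
    refine Finset.sum_bij_ne_zero (fun v _ _ => (v : Fin L)) (fun _ _ _ => Finset.mem_univ _)
      (fun _ _ _ _ _ _ h => Subtype.ext h) ?_ (fun _ _ _ => rfl)
    intro w _ hw
    refine ⟨⟨w, ?_⟩, Finset.mem_univ _, hw, rfl⟩
    rintro ⟨k, rfl⟩
    exact hw (by rw [hy, mul_zero])
  have hzero := Matrix.eq_zero_of_mulVec_eq_zero hdet hsub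
  have hy0 : y = 0 := by
    funext v
    by_cases hv : v ∈ Set.range c
    · obtain ⟨k, rfl⟩ := hv
      exact hy k
    · exact congrFun hzero ⟨v, hv⟩
  have hx0 : x = 0 := by rw [← hyx, hy0, Matrix.mulVec_zero]
  have := congrFun hx0 j
  simp only [x, Matrix.col_apply, Matrix.sub_apply, Pi.zero_apply] at this
  exact (sub_eq_zero.1 this).symm

theorem genericallyIdentifiable_of_hasLinkage {c : Fin p → Fin L}
    {𝒩 : Set (Matrix (Fin L) (Fin L) (RatFunc ℝ))} (h𝒩 : 𝒩 ⊆ rationalNetworks D)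
    (h : ∀ i, HasLinkage D (outNeighbors D i) (Set.range c)) :
    GenericallyIdentifiable D c 𝒩 (edges D) := by
  classical
  intro d n
  choose φ hφ using fun i => (h i).exists_isLinking
  filter_upwards [ae_all_iff.2 fun i => (hφ i).ae_det_ne_zero d n] with P hP hG G' hG' hT e _
  exact (hφ e.1).column_eq (h𝒩 hG) (h𝒩 hG') (hP e.1) hT e.2

end Sufficiency

/-! ### Proper and stable transfer functions -/

theorem isProperTF_iff_intDegree {f : RatFunc ℝ} : IsProperTF f ↔ f.intDegree ≤ 0 := by
  unfold IsProperTF RatFunc.intDegree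
  omega

theorem IsProperTF.add {f g : RatFunc ℝ} (hf : IsProperTF f) (hg : IsProperTF g) :
    IsProperTF (f + g) := by
  rw [isProperTF_iff_intDegree] at *
  by_cases h0 : g = 0
  · simpa [h0] using hf
  by_cases h1 : f + g = 0
  · simp [h1]
  · exact (RatFunc.intDegree_add_le h0 h1).trans (max_le hf hg)

theorem IsProperTF.mul {f g : RatFunc ℝ} (hf : IsProperTF f) (hg : IsProperTF g) :
    IsProperTF (f * g) := by
  rw [isProperTF_iff_intDegree] at *
  by_cases h0 : f = 0
  · simp [h0]
  by_cases h1 : g = 0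
  · simp [h1]
  · rw [RatFunc.intDegree_mul h0 h1]
    omega

theorem IsProperTF.neg {f : RatFunc ℝ} (hf : IsProperTF f) : IsProperTF (-f) := by
  rw [isProperTF_iff_intDegree] at *
  rwa [RatFunc.intDegree_neg]

theorem isProperTF_C (r : ℝ) : IsProperTF (RatFunc.C r) := by
  rw [isProperTF_iff_intDegree, RatFunc.intDegree_C]

theorem isProperTF_zero : IsProperTF 0 := by
  rw [isProperTF_iff_intDegree, RatFunc.intDegree_zero]

theorem isProperTF_one : IsProperTF 1 := by
  rw [isProperTF_iff_intDegree, RatFunc.intDegree_one]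

theorem IsProperTF.sum {ι : Type*} {s : Finset ι} {f : ι → RatFunc ℝ}
    (h : ∀ a ∈ s, IsProperTF (f a)) : IsProperTF (∑ a ∈ s, f a) :=
  Finset.sum_induction _ _ (fun _ _ => IsProperTF.add) isProperTF_zero h

theorem IsStableTF.of_denom_dvd_mul {f g h : RatFunc ℝ} (hf : IsStableTF f) (hg : IsStableTF g)
    (hh : h.denom ∣ f.denom * g.denom) : IsStableTF h := by
  intro z hz
  obtain ⟨q, hq⟩ := hh
  have h0 : aeval z f.denom * aeval z g.denom = 0 := by
    rw [← map_mul, hq, map_mul, hz, zero_mul]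
  exact (mul_eq_zero.1 h0).elim (hf z) (hg z)

theorem IsStableTF.add {f g : RatFunc ℝ} (hf : IsStableTF f) (hg : IsStableTF g) :
    IsStableTF (f + g) :=
  hf.of_denom_dvd_mul hg (RatFunc.denom_add_dvd f g)

theorem IsStableTF.mul {f g : RatFunc ℝ} (hf : IsStableTF f) (hg : IsStableTF g) :
    IsStableTF (f * g) :=
  hf.of_denom_dvd_mul hg (RatFunc.denom_mul_dvd f g)

theorem isStableTF_C (r : ℝ) : IsStableTF (RatFunc.C r) := by
  intro z hz
  simp [RatFunc.denom_C] at hz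

/-- `f` vanishes at infinity. The zero function is listed separately because its `intDegree` is `0`
by convention. -/
def IsStrictlyProperTF (f : RatFunc ℝ) : Prop := f = 0 ∨ f.intDegree < 0

theorem IsStrictlyProperTF.isProperTF {f : RatFunc ℝ} (hf : IsStrictlyProperTF f) :
    IsProperTF f := by
  rcases hf with rfl | hf
  · exact isProperTF_zero
  · exact isProperTF_iff_intDegree.2 hf.le

theorem IsStrictlyProperTF.one_add_ne_zero {f : RatFunc ℝ} (hf : IsStrictlyProperTF f) :
    1 + f ≠ 0 := by
  intro h
  have h1 : f = -1 := by linear_combination h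
  rcases hf with rfl | hf
  · simp at h
  · rw [h1, RatFunc.intDegree_neg, RatFunc.intDegree_one] at hf
    exact lt_irrefl _ hf

theorem IsStrictlyProperTF.isProperTF_one_add_inv {f : RatFunc ℝ} (hf : IsStrictlyProperTF f) :
    IsProperTF (1 + f)⁻¹ := by
  rw [isProperTF_iff_intDegree, RatFunc.intDegree_inv]
  rcases eq_or_ne f 0 with rfl | h0
  · simp
  have hlt := hf.resolve_left h0
  have h1 : (1 + f) + -f = 1 := by ring
  have h2 := RatFunc.intDegree_add_le (neg_ne_zero.2 h0) (h1 ▸ one_ne_zero)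
  rw [h1, RatFunc.intDegree_one, RatFunc.intDegree_neg] at h2
  have := (le_max_iff.1 h2).resolve_right (by omega)
  omega

theorem isStrictlyProperTF_div_X_pow {q : ℝ[X]} {m : ℕ} (h : q.natDegree < m) :
    IsStrictlyProperTF (algebraMap ℝ[X] (RatFunc ℝ) q / algebraMap ℝ[X] (RatFunc ℝ) (X ^ m)) := by
  rcases eq_or_ne q 0 with rfl | hq
  · left
    simp
  · right
    have hinj := IsFractionRing.injective ℝ[X] (RatFunc ℝ)
    rw [RatFunc.intDegree_div ((map_ne_zero_iff _ hinj).2 hq)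
      ((map_ne_zero_iff _ hinj).2 (pow_ne_zero _ X_ne_zero)), RatFunc.intDegree_polynomial,
      RatFunc.intDegree_polynomial, natDegree_X_pow]
    omega

theorem isStableTF_div_X_pow (q : ℝ[X]) (m : ℕ) :
    IsStableTF (algebraMap ℝ[X] (RatFunc ℝ) q / algebraMap ℝ[X] (RatFunc ℝ) (X ^ m)) := by
  intro z hz
  obtain ⟨r, hr⟩ := RatFunc.denom_div_dvd q (X ^ m)
  have h0 : z ^ m = 0 := by
    have := congrArg (aeval z) hr
    rwa [map_mul, hz, zero_mul, map_pow, aeval_X] at this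
  simp [eq_zero_of_pow_eq_zero h0]

/-- Every vector of rational functions has a nonzero multiple whose entries are strictly proper with
all poles at the origin: clear denominators, then divide by a high power of `z`. -/
theorem exists_smul_strictlyProper_stable {ι : Type*} [Fintype ι] (y : ι → RatFunc ℝ) :
    ∃ μ : RatFunc ℝ, μ ≠ 0 ∧ ∀ v, IsStrictlyProperTF (μ * y v) ∧ IsStableTF (μ * y v) := by
  have hinj := IsFractionRing.injective ℝ[X] (RatFunc ℝ)
  obtain ⟨b, hb⟩ := IsLocalization.exist_integer_multiples_of_finite (nonZeroDivisors ℝ[X]) y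
  choose q hq using hb
  let m := ∑ v, (q v).natDegree + 1
  have hm : ∀ v, (q v).natDegree < m := fun v => Nat.lt_succ_of_le
    (Finset.single_le_sum (f := fun v => (q v).natDegree) (fun _ _ => Nat.zero_le _)
      (Finset.mem_univ v))
  have key : ∀ v, algebraMap ℝ[X] (RatFunc ℝ) b / algebraMap ℝ[X] (RatFunc ℝ) (X ^ m) * y v =
      algebraMap ℝ[X] (RatFunc ℝ) (q v) / algebraMap ℝ[X] (RatFunc ℝ) (X ^ m) := by
    intro v
    rw [hq v, Algebra.smul_def, div_mul_eq_mul_div]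
  refine ⟨algebraMap ℝ[X] (RatFunc ℝ) b / algebraMap ℝ[X] (RatFunc ℝ) (X ^ m),
    div_ne_zero ((map_ne_zero_iff _ hinj).2 (nonZeroDivisors.ne_zero b.2))
      ((map_ne_zero_iff _ hinj).2 (pow_ne_zero _ X_ne_zero)), fun v => ?_⟩
  rw [key]
  exact ⟨isStrictlyProperTF_div_X_pow (hm v), isStableTF_div_X_pow _ _⟩

/-! ### Without a linkage, indistinguishable networks exist -/

section Necessity

variable {L p : ℕ} {D : Digraph (Fin L)}

/-- If `A` is not linked to `B`, then Hall's theorem yields a set `S ⊆ Bᶜ` of nodes such that fewer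
than `|S|` rows of `I - G` outside `A` are nonzero on the columns in `S`; hence a vector supported
in `S` is sent by `I - G` to a vector supported in `A`. -/
theorem exists_ne_zero_of_not_hasLinkage {A B : Set (Fin L)} (h : ¬ HasLinkage D A B)
    {G : Matrix (Fin L) (Fin L) (RatFunc ℝ)} (hG : IsConsistent D G) :
    ∃ y : Fin L → RatFunc ℝ, y ≠ 0 ∧ (∀ v ∈ B, y v = 0) ∧ ∀ w ∉ A, ((1 - G) *ᵥ y) w = 0 := by
  classical
  let t : ↥Bᶜ → Finset (Fin L) := fun v =>
    Finset.univ.filter fun w => w ∉ A ∧ (w = v ∨ D.Adj v w)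
  have hHall : ¬ ∀ s : Finset ↥Bᶜ, s.card ≤ (s.biUnion t).card := by
    intro hs
    obtain ⟨f, hf, hft⟩ := (Finset.all_card_le_biUnion_card_iff_exists_injective t).1 hs
    refine h (IsLinking.hasLinkage (φ := fun v => if hv : v ∈ Bᶜ then f ⟨v, hv⟩ else v) ⟨?_, ?_⟩)
    · intro v hv w hw hvw
      simp only [dif_pos hv, dif_pos hw] at hvw
      exact congrArg Subtype.val (hf hvw)
    · intro v hv
      have := (Finset.mem_filter.1 (hft ⟨v, hv⟩)).2
      have hv' : v ∈ Bᶜ := hv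
      simpa only [dif_pos hv'] using this
  push Not at hHall
  obtain ⟨s, hs⟩ := hHall
  let g : s → Fin L := fun v => v.1
  have hg : Function.Injective g := Subtype.val_injective.comp Subtype.val_injective
  let M : Matrix (s.biUnion t) s (RatFunc ℝ) := (1 - G).submatrix Subtype.val g
  have hker : LinearMap.ker M.mulVecLin ≠ ⊥ := by
    apply LinearMap.ker_ne_bot_of_finrank_lt
    rwa [Module.finrank_fintype_fun_eq_card, Module.finrank_fintype_fun_eq_card,
      Fintype.card_coe, Fintype.card_coe]
  obtain ⟨z, hz, hz0⟩ := Submodule.exists_mem_ne_zero_of_ne_bot hker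
  have hMz : M *ᵥ z = 0 := hz
  have hsum : ∀ w, ((1 - G) *ᵥ Function.extend g z 0) w = ∑ v, (1 - G) w (g v) * z v := by
    intro w
    rw [Matrix.mulVec, dotProduct]
    symm
    refine Finset.sum_of_injOn g hg.injOn (fun _ _ => Finset.mem_coe.2 (Finset.mem_univ _)) ?_ ?_
    · intro v _ hv
      rw [Function.extend_apply', Pi.zero_apply, mul_zero]
      rintro ⟨a, ha⟩
      exact hv ⟨a, Finset.mem_coe.2 (Finset.mem_univ _), ha⟩
    · intro v _
      rw [hg.extend_apply]
  refine ⟨Function.extend g z 0, fun h0 => hz0 ?_, fun v hv => ?_, fun w hw => ?_⟩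
  · funext v
    rw [← hg.extend_apply z 0 v, h0]
    rfl
  · rw [Function.extend_apply', Pi.zero_apply]
    rintro ⟨a, rfl⟩
    exact a.1.2 hv
  · rw [hsum]
    by_cases hwt : w ∈ s.biUnion t
    · exact congrFun hMz ⟨w, hwt⟩
    · refine Finset.sum_eq_zero fun v _ => ?_
      have hv : ¬ (w = g v ∨ D.Adj (g v) w) := fun hv =>
        hwt (Finset.mem_biUnion.2 ⟨v.1, v.2, Finset.mem_filter.2 ⟨Finset.mem_univ _, hw, hv⟩⟩)
      push Not at hv
      have hGwv : G w (g v) = 0 := by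
        by_contra h0
        exact hv.2 (hG _ _ h0)
      rw [Matrix.sub_apply, Matrix.one_apply_ne hv.1, hGwv, sub_zero, zero_mul]

/-- The rank-one change `T' = (I + w eᵢᵀ) T` of `T = (I - G)⁻¹` alters no row of `T` at which `w`
vanishes, and changes only column `i` of `G`, by a nonzero multiple of `(I - G) w`. If the
latter is supported on the out-neighbours of `i`, the new network is consistent with the graph; if
`w` is strictly proper and stable, the new network is well posed. -/
theorem exists_indistinguishable {c : Fin p → Fin L} {i : Fin L}
    {G : Matrix (Fin L) (Fin L) (RatFunc ℝ)} (hG : G ∈ wellPosedNetworks D)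
    {w : Fin L → RatFunc ℝ} (hw : w ≠ 0) (hwc : ∀ k, w (c k) = 0)
    (hwN : ∀ v ∉ outNeighbors D i, ((1 - G) *ᵥ w) v = 0)
    (hws : ∀ v, IsStrictlyProperTF (w v) ∧ IsStableTF (w v)) :
    ∃ G' ∈ wellPosedNetworks D,
      selectionMatrix c * (1 - G)⁻¹ = selectionMatrix c * (1 - G')⁻¹ ∧
        ∃ j, D.Adj i j ∧ G j i ≠ G' j i := by
  classical
  obtain ⟨hcons, hunit, hprop, hT⟩ := hG
  have hu : IsUnit (1 - G).det := (Matrix.isUnit_iff_isUnit_det _).1 hunit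
  have hs0 : 1 + w i ≠ 0 := (hws i).1.one_add_ne_zero
  set s : RatFunc ℝ := (1 + w i)⁻¹ with hs
  set x := (1 - G) *ᵥ w with hx
  set W : Matrix (Fin L) (Fin L) (RatFunc ℝ) := Matrix.vecMulVec w (Pi.single i 1) with hW
  have hWapp : ∀ a b, W a b = if b = i then w a else 0 := by
    intro a b
    simp [W, Matrix.vecMulVec_apply, Pi.single_apply]
  have hGW : ∀ a b, ((1 - G) * W) a b = if b = i then x a else 0 := by
    intro a b
    rw [hW, Matrix.mul_vecMulVec, ← hx]
    simp [Matrix.vecMulVec_apply, Pi.single_apply]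
  have hWW : W * W = w i • W := by
    ext1 a b
    rw [Matrix.mul_apply, Matrix.smul_apply, hWapp]
    simp only [hWapp]
    simp [mul_comm]
  have hUV : (1 + W) * (1 - s • W) = 1 := by
    have h1 : (1 + W) * (1 - s • W) = 1 + W - s • W - s • (W * W) := by
      rw [mul_sub, mul_one, add_mul, one_mul, Matrix.mul_smul]
      abel
    have h2 : s + s * w i = 1 := by
      rw [hs]
      field_simp
    rw [h1, hWW, smul_smul, sub_sub, ← add_smul, h2, one_smul, add_sub_cancel_right]
  let G' := G + s • ((1 - G) * W)
  have hG' : 1 - G' = (1 - G) * (1 - s • W) := by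
    rw [Matrix.mul_sub, Matrix.mul_one, Matrix.mul_smul]
    simp only [G']
    abel
  have hG'app : ∀ a b, G' a b = G a b + s * (if b = i then x a else 0) := by
    intro a b
    simp only [G', Matrix.add_apply, Matrix.smul_apply, hGW, smul_eq_mul]
  have hinv : (1 + W) * (1 - G)⁻¹ * (1 - G') = 1 := by
    rw [hG', Matrix.mul_assoc, ← Matrix.mul_assoc (1 - G)⁻¹, Matrix.nonsing_inv_mul _ hu,
      Matrix.one_mul, hUV]
  have hT' : (1 - G')⁻¹ = (1 + W) * (1 - G)⁻¹ := Matrix.inv_eq_left_inv hinv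
  have hT'app : ∀ a b, (1 - G')⁻¹ a b = (1 - G)⁻¹ a b + w a * (1 - G)⁻¹ i b := by
    intro a b
    rw [hT', Matrix.add_mul, Matrix.one_mul, Matrix.add_apply, Matrix.mul_apply]
    simp only [hWapp]
    simp
  have hxprop : ∀ a, IsProperTF (x a) := by
    intro a
    rw [hx, Matrix.mulVec, dotProduct]
    refine IsProperTF.sum fun b _ => IsProperTF.mul ?_ (hws b).1.isProperTF
    rw [Matrix.sub_apply, sub_eq_add_neg, Matrix.one_apply]
    refine IsProperTF.add ?_ (hprop a b).neg
    split_ifs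
    · exact isProperTF_one
    · exact isProperTF_zero
  have hx0 : x ≠ 0 := by
    intro h0
    apply hw
    have := congrArg ((1 - G)⁻¹ *ᵥ ·) h0
    simpa only [hx, Matrix.mulVec_mulVec, Matrix.nonsing_inv_mul _ hu, Matrix.one_mulVec,
      Matrix.mulVec_zero] using this
  refine ⟨G', ⟨fun a b hab => ?_, IsUnit.of_mul_eq_one_right _ hinv, fun a b => ?_, fun a b => ?_⟩,
    ?_, ?_⟩
  · rw [hG'app] at hab
    by_cases h0 : G a b = 0
    · rw [h0, zero_add] at hab
      have hab' := (mul_ne_zero_iff.1 hab).2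
      split_ifs at hab' with hb
      · subst hb
        by_contra hadj
        exact hab' (hwN a hadj)
      · exact absurd rfl hab'
    · exact hcons a b h0
  · rw [hG'app]
    refine (hprop a b).add ((hws i).1.isProperTF_one_add_inv.mul ?_)
    split_ifs
    · exact hxprop a
    · exact isProperTF_zero
  · rw [hT'app]
    exact ⟨(hT a b).1.add ((hws a).1.isProperTF.mul (hT i b).1),
      (hT a b).2.add ((hws a).2.mul (hT i b).2)⟩
  · have hCW : selectionMatrix c * W = 0 := by
      ext1 k b
      simp [selectionMatrix, Matrix.mul_apply, hWapp, hwc]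
    rw [hT', ← Matrix.mul_assoc, Matrix.mul_add, hCW, add_zero, Matrix.mul_one]
  · obtain ⟨j, hj⟩ := Function.ne_iff.1 hx0
    refine ⟨j, ?_, ?_⟩
    · by_contra hadj
      exact hj (hwN j hadj)
    · rw [hG'app, if_pos rfl]
      intro h0
      exact mul_ne_zero (inv_ne_zero hs0) hj (by linear_combination -h0)

/-- The real matrix of gains of the static parametrization, in which every edge has delay and order
zero and its transfer function is the constant `κ`. -/
noncomputable def staticGain (D : Digraph (Fin L))
    (P : ParamIndex D (fun _ _ => 0) → ℝ) : Matrix (Fin L) (Fin L) ℝ :=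
  open Classical in
  Matrix.of fun i j => if h : D.Adj j i then P ⟨⟨(j, i), h⟩, Sum.inl ()⟩ else 0

theorem paramNetwork_static (P : ParamIndex D (fun _ _ => 0) → ℝ) :
    paramNetwork D (fun _ _ => 0) (fun _ _ => 0) P = (staticGain D P).map RatFunc.C := by
  ext1 i j
  simp only [paramNetwork, staticGain, Matrix.map_apply, Matrix.of_apply]
  split_ifs
  · simp [monicTF]
  · simp

/-- A static network is well posed as soon as `I - G` is invertible. -/
theorem static_mem_wellPosedNetworks {P : ParamIndex D (fun _ _ => 0) → ℝ}
    (hP : (1 - staticGain D P).det ≠ 0) :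
    paramNetwork D (fun _ _ => 0) (fun _ _ => 0) P ∈ wellPosedNetworks D := by
  classical
  have hsub : 1 - paramNetwork D (fun _ _ => 0) (fun _ _ => 0) P =
      (RatFunc.C (K := ℝ)).mapMatrix (1 - staticGain D P) := by
    rw [map_sub, map_one, paramNetwork_static]
    rfl
  have hmul : (1 - paramNetwork D (fun _ _ => 0) (fun _ _ => 0) P) *
      (RatFunc.C (K := ℝ)).mapMatrix (1 - staticGain D P)⁻¹ = 1 := by
    rw [hsub, ← map_mul, Matrix.mul_nonsing_inv _ (isUnit_iff_ne_zero.2 hP), map_one]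
  refine ⟨fun i j hij => ?_, IsUnit.of_mul_eq_one _ hmul, fun i j => ?_, fun i j => ?_⟩
  · by_contra h
    exact hij (by simp [paramNetwork, h])
  · rw [paramNetwork_static]
    exact isProperTF_C _
  · rw [Matrix.inv_eq_right_inv hmul]
    exact ⟨isProperTF_C _, isStableTF_C _⟩

theorem continuous_det_one_sub_staticGain :
    Continuous fun P : ParamIndex D (fun _ _ => 0) → ℝ => (1 - staticGain D P).det := by
  refine Continuous.matrix_det (continuous_const.sub (continuous_matrix fun i j => ?_))
  simp only [staticGain, Matrix.of_apply]
  split_ifs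
  · exact continuous_apply _
  · exact continuous_const

theorem hasLinkage_of_genericallyIdentifiable {c : Fin p → Fin L}
    {𝒩 : Set (Matrix (Fin L) (Fin L) (RatFunc ℝ))} (h𝒩 : wellPosedNetworks D ⊆ 𝒩)
    (h : GenericallyIdentifiable D c 𝒩 (edges D)) (i : Fin L) :
    HasLinkage D (outNeighbors D i) (Set.range c) := by
  by_contra hlink
  -- The invertible static networks form a nonempty open set of parameters, so one of them is
  -- identifiable.
  have hopen : IsOpen {P : ParamIndex D (fun _ _ => 0) → ℝ | (1 - staticGain D P).det ≠ 0} :=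
    isOpen_ne_fun continuous_det_one_sub_staticGain continuous_const
  have hne : {P : ParamIndex D (fun _ _ => 0) → ℝ | (1 - staticGain D P).det ≠ 0}.Nonempty := by
    refine ⟨0, ?_⟩
    have : staticGain D 0 = 0 := by
      ext1 i j
      simp [staticGain]
    simp [this]
  obtain ⟨P, hPdet, hP⟩ :=
    (Measure.dense_of_ae (h (fun _ _ => 0) (fun _ _ => 0))).inter_open_nonempty _ hopen hne
  have hG := static_mem_wellPosedNetworks hPdet
  obtain ⟨y, hy0, hyc, hyN⟩ := exists_ne_zero_of_not_hasLinkage hlink hG.1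
  obtain ⟨μ, hμ, hμy⟩ := exists_smul_strictlyProper_stable y
  obtain ⟨G', hG', hT, j, hj, hne⟩ := exists_indistinguishable (c := c) hG
    (w := μ • y) (smul_ne_zero hμ hy0) (fun k => by simp [hyc _ (Set.mem_range_self k)])
    (fun v hv => by rw [Matrix.mulVec_smul, Pi.smul_apply, hyN v hv, smul_zero]) hμy
  exact hne (hP (h𝒩 hG) G' (h𝒩 hG') hT (i, j) hj)

end Necessity

theorem wellPosedNetworks_subset_rationalNetworks {L : ℕ} (D : Digraph (Fin L)) :
    wellPosedNetworks D ⊆ rationalNetworks D :=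
  fun _ hG => ⟨hG.1, hG.2.1⟩

end DynNet

theorem mainTheorem2 {L p : ℕ} (D : Digraph (Fin L)) (hD : ∀ i, ¬ D.Adj i i)
    (c : Fin p → Fin L) :
    List.TFAE [
      DynNet.GenericallyIdentifiable D c (DynNet.rationalNetworks D) (DynNet.edges D),
      DynNet.GenericallyIdentifiable D c (DynNet.wellPosedNetworks D) (DynNet.edges D),
      ∀ i, DynNet.maxDisjointPaths D (DynNet.outNeighbors D i) (Set.range c) =
        DynNet.outDegree D i,
      ∀ i, ∃ π : ∀ j : DynNet.outNeighbors D i, DynNet.DiPath D {(j : Fin L)} (Set.range c),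
        Pairwise fun j k => (π j).verts.Disjoint (π k).verts] := by
  tfae_have 1 → 4 := fun h i => DynNet.hasLinkage_of_genericallyIdentifiable
    (DynNet.wellPosedNetworks_subset_rationalNetworks D) h i
  tfae_have 2 → 4 := fun h i => DynNet.hasLinkage_of_genericallyIdentifiable subset_rfl h i
  tfae_have 4 → 1 := fun h => DynNet.genericallyIdentifiable_of_hasLinkage subset_rfl h
  tfae_have 4 → 2 := fun h => DynNet.genericallyIdentifiable_of_hasLinkage
    (DynNet.wellPosedNetworks_subset_rationalNetworks D) h
  tfae_have 3 ↔ 4 := forall_congr' fun _ => DynNet.maxDisjointPaths_eq_ncard_iff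
  tfae_finish
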